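/- **Setting.** Let $\Omega\subseteq\mathbb R^d$ be an experimental region. For $j=1,\dots,m$ let $M_j=(h_j,\boldsymbol g_j,\boldsymbol\beta_j)$ be a generalized linear model on $\Omega$ with link function $h_j$, basis functions $\boldsymbol g_j=(g_{j,1},\dots,g_{j,l_j})^\top$ and regression coefficients $\boldsymbol\beta_j\in\mathbb R^{l_j}$. That is, under $M_j$ the response $Y(\boldsymbol x)$, $\boldsymbol x\in\Omega$, follows a distribution in a fixed (natural) exponential family, with mean $\mu_j(\boldsymbol x)=h_j^{-1}(\boldsymbol\beta_j^\top\boldsymbol g_j(\boldsymbol x))$ and positive finite variance, and $h_j$ is differentiable at $\mu_j(\boldsymbol x)$ with $h_j'(\mu_j(\boldsymbol x))\neq0$. Put $w_j(\boldsymbol x)=\big[\operatorname{Var}_{M_j}(Y(\boldsymbol x))\,h_j'(\mu_j(\boldsymbol x))^2\big]^{-1}$. A design $\xi$ is a probability measure on $\Omega$ with finitely many support points $\boldsymbol x_i$ and positive weights $\lambda_i$, $\sum_i\lambda_i=1$. Its information matrix under $M_j$ is $\mathsf I_j(\xi)=\sum_i\lambda_i w_j(\boldsymbol x_i)\boldsymbol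 g_j(\boldsymbol x_i)\boldsymbol g_j(\boldsymbol x_i)^\top$. Let $\boldsymbol f_j:\mathbb R^{l_j}\to\mathbb R^{q_j}$ be differentiable at $\boldsymbol\beta_j$ with Jacobian matrix $\mathsf B_j$ there. If $\mathsf I_j(\xi)$ is nonsingular, put $\mathsf F_j(\xi)=\mathsf B_j\mathsf I_j(\xi)^{-1}\mathsf B_j^\top$ and $$\Phi_p^j(\xi)=\big(q_j^{-1}\operatorname{tr}[\mathsf F_j(\xi)^p]\big)^{1/p},\qquad 0<p<\infty;$$ for $p=0$ either of the two usual conventions $\Phi_0^j(\xi)=\det(\mathsf F_j(\xi))^{1/q_j}$ (the limit of $\Phi_p^j$ as $p\to0$) or $\Phi_0^j(\xi)=\log\det\mathsf F_j(\xi)$ may be used, the same one for all $j$. If $\mathsf I_j(\xi)$ is singular, $\Phi_p^j(\xi)=+\infty$. Fix $p\in[0,\infty)$ (with its convention if $p=0$). Suppose that for every $j$ there is a locally optimal design $\xi^{\mathrm{opt}_j}$, i.e. one that minimizes $\Phi_p^j$ over all designs, and that its value $\Phi_p^{\mathrm{opt}_j}=\Phi_p^j(\xi^{\mathrm{opt}_j})$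 is finite and positive, so that the efficiencies $\Phi_p^{\mathrm{opt}_j}/\Phi_p^j(\xi)\in[0,1]$ make sense. With $\mathcal M'=\{M_1,\dots,M_m\}$, define $$\mathrm{se}(\xi,\mathcal M')=\sum_{j=1}^m\exp\!\Big(\frac{\Phi_p^j(\xi)}{\Phi_p^{\mathrm{opt}_j}}\Big),\qquad \mathrm{lse}(\xi,\mathcal M')=\ln \mathrm{se}(\xi,\mathcal M'),$$ with values in $[0,+\infty]$ and $[-\infty,+\infty]$ respectively. For a design $\xi$ with $\mathrm{se}(\xi,\mathcal M')<\infty$ and $\boldsymbol x\in\Omega$ let $$\phi(\boldsymbol x,\xi)=\lim_{\alpha\to0^+}\frac{\mathrm{se}((1-\alpha)\xi+\alpha\delta_{\boldsymbol x},\mathcal M')-\mathrm{se}(\xi,\mathcal M')}{\alpha},$$ where $\delta_{\boldsymbol x}$ is the design with the single support point $\boldsymbol x$. **Theorem (General Equivalence Theorem).** For every design $\xi$ with $\mathrm{se}(\xi,\mathcal M')<\infty$ the directional derivative $\phi(\boldsymbol x,\xi)$ exists as a real number for every $\boldsymbol x\in\Omega$. Moreover, for every design $\xi$ the following are equivalent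 (conditions 3 and 4 include that the derivatives exist, and in particular that $\mathrm{se}(\xi,\mathcal M')<\infty$): 1. $\xi$ minimizes $\mathrm{lse}(\cdot,\mathcal M')$ over all designs; 2. $\xi$ minimizes $\mathrm{se}(\cdot,\mathcal M')$ over all designs; 3. $\phi(\boldsymbol x,\xi)\ge0$ for every $\boldsymbol x\in\Omega$, with equality if $\boldsymbol x$ is a support point of $\xi$; 4. $\phi(\boldsymbol x,\xi)\ge0$ for every $\boldsymbol x\in\Omega$. -/

import Mathlib

open Filter Topology MeasureTheory ProbabilityTheory
open scoped ENNReal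

noncomputable section

namespace OptDesign

/-- The data of a generalized linear model on `ℝ^d` with `l` basis functions: the triple
(link function, basis functions, regression coefficients), together with the set of mean values
on which the link is defined and the law of the response at each point. -/
structure GLM (d l : ℕ) where
  /-- the link function `h` -/
  link : ℝ → ℝ
  /-- the mean values on which `h` is a link function, e.g. `(0, 1)` for the logit link -/
  meanDomain : Set ℝ
  /-- the basis functions `g = (g_1, …, g_l)` -/
  basis : (Fin d → ℝ) → Fin l → ℝ
  /-- the regression coefficients `β` -/
  coef : Fin l → ℝ
  /-- the law of the response `Y(x)` -/
  response : (Fin d → ℝ) → Measure ℝ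

namespace GLM

variable {d l q : ℕ} (M : GLM d l)

/-- The linear predictor `η(x) = βᵀ g(x)`. -/
def predictor (x : Fin d → ℝ) : ℝ := ∑ k, M.coef k * M.basis x k

/-- The mean `μ(x) = h⁻¹(βᵀ g(x))`. -/
def mean (x : Fin d → ℝ) : ℝ := Function.invFunOn M.link M.meanDomain (M.predictor x)

/-- The weight `w(x) = [Var(Y(x)) h'(μ(x))²]⁻¹`. -/
def weight (x : Fin d → ℝ) : ℝ := (Var[id; M.response x] * deriv M.link (M.mean x) ^ 2)⁻¹

/-- `M` is a generalized linear model on the experimental region `Ω`, with responses in the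
(natural) exponential family generated by `ν`: the family of laws with density
`exp (θ y - b(θ))` with respect to `ν`. A known dispersion parameter is absorbed in `ν` and `θ`. -/
structure IsGLM (ν : Measure ℝ) (Ω : Set (Fin d → ℝ)) : Prop where
  link_injOn : Set.InjOn M.link M.meanDomain
  predictor_mem : ∀ x ∈ Ω, M.predictor x ∈ M.link '' M.meanDomain
  /-- in particular `h` is differentiable at `μ(x)` -/
  deriv_link_ne_zero : ∀ x ∈ Ω, deriv M.link (M.mean x) ≠ 0
  response_mem : ∀ x ∈ Ω, ∃ θ : ℝ, Integrable (fun y => Real.exp (θ * y)) ν ∧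
    M.response x = ν.tilted (fun y => θ * y)
  response_memLp : ∀ x ∈ Ω, MemLp id 2 (M.response x)
  response_mean : ∀ x ∈ Ω, ∫ y, y ∂(M.response x) = M.mean x
  response_variance : ∀ x ∈ Ω, 0 < Var[id; M.response x]

/-- The Fisher information matrix `I(ξ, M) = ∑ᵢ λᵢ w(xᵢ) g(xᵢ) g(xᵢ)ᵀ`. -/
def fisherInfo (ξ : (Fin d → ℝ) →₀ ℝ) : Matrix (Fin l) (Fin l) ℝ :=
  ξ.sum fun x a => (a * M.weight x) • Matrix.vecMulVec (M.basis x) (M.basis x)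

/-- The Jacobian matrix `∂f(β)/∂βᵀ` at the coefficients of the model. -/
def jacobian (f : (Fin l → ℝ) → Fin q → ℝ) : Matrix (Fin q) (Fin l) ℝ :=
  LinearMap.toMatrix' (fderiv ℝ f M.coef).toLinearMap

/-- `F(ξ) = B I(ξ)⁻¹ Bᵀ`, meaningful if `I(ξ)` is invertible. -/
def covMatrix (f : (Fin l → ℝ) → Fin q → ℝ) (ξ : (Fin d → ℝ) →₀ ℝ) :
    Matrix (Fin q) (Fin q) ℝ :=
  M.jacobian f * (M.fisherInfo ξ)⁻¹ * (M.jacobian f).transpose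

end GLM

/-- An approximate design on `Ω`: finitely many support points in `Ω` with positive weights
adding up to `1`. The support points are the elements of `ξ.support`. -/
def IsDesign {d : ℕ} (Ω : Set (Fin d → ℝ)) (ξ : (Fin d → ℝ) →₀ ℝ) : Prop :=
  (∀ x, 0 ≤ ξ x) ∧ ↑ξ.support ⊆ Ω ∧ (ξ.sum fun _ a => a) = 1

/-- The design with the single support point `x`. -/
def pointDesign {d : ℕ} (x : Fin d → ℝ) : (Fin d → ℝ) →₀ ℝ := Finsupp.single x 1

/-- The members of the `Φ_p` family: `0 < p < ∞`, and the two usual forms of the case `p = 0`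
(D-optimality), namely `lim_{p → 0} Φ_p`, the geometric mean of the eigenvalues, and `log det`. -/
inductive PhiKind where
  | power (p : ℝ) (hp : 0 < p)
  | detRoot
  | logDet

/-- The scalar summary of a positive semidefinite matrix `F`: `(q⁻¹ tr F^p)^(1/p)`, where the real
power `F^p` is taken by functional calculus, or `(det F)^(1/q)`, or `log (det F)`. -/
def PhiKind.scalar {q : ℕ} (F : Matrix (Fin q) (Fin q) ℝ) : PhiKind → ℝ
  | .power p _ => ((q : ℝ)⁻¹ * (cfc (fun t : ℝ => t ^ p) F).trace) ^ (1 / p)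
  | .detRoot => F.det ^ (1 / (q : ℝ))
  | .logDet => Real.log F.det

open Classical in
/-- The criterion `Φ_p(ξ, M)`, which is `+∞` if the information matrix of `ξ` is singular. -/
def Phi {d l q : ℕ} (c : PhiKind) (M : GLM d l) (f : (Fin l → ℝ) → Fin q → ℝ)
    (ξ : (Fin d → ℝ) →₀ ℝ) : EReal :=
  if IsUnit (M.fisherInfo ξ).det then ((c.scalar (M.covMatrix f ξ) : ℝ) : EReal) else ⊤

/-- `ξ` minimizes the criterion `Ψ` over all designs on `Ω`. -/
def Minimizes {d : ℕ} {R : Type*} [LE R] (Ω : Set (Fin d → ℝ)) (Ψ : ((Fin d → ℝ) →₀ ℝ) → R)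
    (ξ : (Fin d → ℝ) →₀ ℝ) : Prop :=
  IsDesign Ω ξ ∧ ∀ ξ', IsDesign Ω ξ' → Ψ ξ ≤ Ψ ξ'

section Criteria

variable {d m : ℕ} {l q : Fin m → ℕ} (c : PhiKind) (M : ∀ j, GLM d (l j))
  (f : ∀ j, (Fin (l j) → ℝ) → Fin (q j) → ℝ) (ξopt : Fin m → (Fin d → ℝ) →₀ ℝ)

/-- The sum-of-exponentials criterion `∑ⱼ exp (Φ_p(ξ, Mⱼ) / Φ_p(ξoptⱼ, Mⱼ))`. -/
def se (ξ : (Fin d → ℝ) →₀ ℝ) : ℝ≥0∞ :=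
  ∑ j, EReal.exp (Phi c (M j) (f j) ξ / Phi c (M j) (f j) (ξopt j))

/-- The log-sum-exp criterion. -/
def lse (ξ : (Fin d → ℝ) →₀ ℝ) : EReal := ENNReal.log (se c M f ξopt ξ)

/-- The directional derivative `φ(ξ', ξ)` of `se` at `ξ` in the direction of `ξ'` exists (as a real
number, at a design with a finite criterion value) and equals `D`. -/
def HasDirDeriv (ξ' ξ : (Fin d → ℝ) →₀ ℝ) (D : ℝ) : Prop :=
  se c M f ξopt ξ ≠ ⊤ ∧
  (∀ᶠ α : ℝ in 𝓝[>] 0, se c M f ξopt ((1 - α) • ξ + α • ξ') ≠ ⊤) ∧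
  Tendsto (fun α : ℝ =>
      ((se c M f ξopt ((1 - α) • ξ + α • ξ')).toReal - (se c M f ξopt ξ).toReal) / α)
    (𝓝[>] 0) (𝓝 D)

end Criteria

end OptDesign

end

open OptDesign

/-! The information matrix is linear in the design, so the theorem is the first-order optimality
criterion for a convex function of the matrices `I_j(ξ)`. A continuous choice of subgradients `G` on
the positive definite cone serves as the gradient. The subgradient inequality at both ends of a
segment squeezes difference quotients, so the one-sided derivative towards a design `η` is `∑ j, tr
(G_j (I_j(η) - I_j(ξ)))`. This is the average, with weights `η x`, of the derivatives towards the
points of `η`. Nonnegativity at all points therefore gives nonnegativity towards every design, and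
convexity yields a global minimum. For `η = ξ` the average is `0`, which forces equality on the
support of a minimizer. A minimizer has a finite value, since some mixture of the locally optimal
designs makes all information matrices nonsingular.

The analytic core is that `log tr (B A⁻¹ Bᵀ)^p / p` and `log det (B A⁻¹ Bᵀ)` have continuous
subgradients in `A`. The pairs `(A, BᵀB)` and `(A', BᵀB)` are diagonalized simultaneously
(`exists_simultaneous_diagonalization`). The overlaps of the two bases form weights with row and
column sums `1` (`exists_overlap`), and the inequality reduces to scalar uses of `log x ≤ x - 1`.
Composition with `exp` preserves such subgradients and passes to `Φ_p` and then to the summands of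
`se`. -/

namespace OptDesign

open Matrix Polynomial

/-! ### Functional calculus of symmetric matrices and simultaneous diagonalization -/

section FunctionalCalculus

variable {n k : Type*} [Fintype n] [DecidableEq n] [Fintype k] [DecidableEq k]

-- Near a given point the norms are bounded, so one closed ball contains all spectra and continuity
-- of the functional calculus on a fixed compact set applies.
open scoped Matrix.Norms.L2Operator in
theorem continuous_cfc_of_isHermitian {X : Type*} [TopologicalSpace X]
    {g : ℝ → ℝ} (hg : Continuous g) {M : X → Matrix n n ℝ} (hM : Continuous M)
    (hH : ∀ x, (M x).IsHermitian) : Continuous fun x => cfc g (M x) := by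
  refine Continuous.cfc
    (s := fun x => Metric.closedBall 0 ((‖M x‖ + 1) * ‖(1 : Matrix n n ℝ)‖)) g hM
    (fun x => isCompact_closedBall _ _) (fun x₀ => ?_) (fun x => hg.continuousOn) hH
  have h : ∀ᶠ x in 𝓝 x₀, ‖M x‖ < ‖M x₀‖ + 1 :=
    hM.norm.continuousAt.eventually_lt continuousAt_const (by simp)
  filter_upwards [h] with x hx
  exact (spectrum.subset_closedBall_norm_mul (M x)).trans
    (Metric.closedBall_subset_closedBall (by gcongr))

theorem exists_orthogonal_diagonalization {K : Matrix n n ℝ} (hK : K.IsHermitian) :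
    ∃ U : Matrix n n ℝ, Uᵀ * U = 1 ∧ U * Uᵀ = 1 ∧
      ∀ g : ℝ → ℝ, cfc g K = U * diagonal (g ∘ hK.eigenvalues) * Uᵀ := by
  refine ⟨hK.eigenvectorUnitary, ?_, ?_, fun g => ?_⟩
  · have := Unitary.coe_star_mul_self hK.eigenvectorUnitary
    simpa [star_eq_conjTranspose, conjTranspose_eq_transpose_of_trivial] using this
  · have := Unitary.coe_mul_star_self hK.eigenvectorUnitary
    simpa [star_eq_conjTranspose, conjTranspose_eq_transpose_of_trivial] using this
  · rw [hK.cfc_eq, Matrix.IsHermitian.cfc, Unitary.conjStarAlgAut_apply]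
    simp [star_eq_conjTranspose, conjTranspose_eq_transpose_of_trivial, Function.comp_def]

theorem trace_cfc_eq_sum_eigenvalues {K : Matrix n n ℝ} (hK : K.IsHermitian) (g : ℝ → ℝ) :
    (cfc g K).trace = ∑ i, g (hK.eigenvalues i) := by
  obtain ⟨U, hU, -, hg⟩ := exists_orthogonal_diagonalization hK
  rw [hg, trace_mul_comm, ← Matrix.mul_assoc, hU, Matrix.one_mul, trace_diagonal]
  rfl

theorem trace_cfc_eq_sum_roots {K : Matrix n n ℝ} (hK : K.IsHermitian) (g : ℝ → ℝ) :
    (cfc g K).trace = (K.charpoly.roots.map g).sum := by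
  rw [trace_cfc_eq_sum_eigenvalues hK, hK.roots_charpoly_eq_eigenvalues]
  simp

/-- The nonzero spectra of `C Cᵀ` and `Cᵀ C` agree. -/
theorem trace_cfc_mul_transpose_comm (C : Matrix k n ℝ) {g : ℝ → ℝ} (hg : g 0 = 0) :
    (cfc g (C * Cᵀ)).trace = (cfc g (Cᵀ * C)).trace := by
  have h1 : (C * Cᵀ).IsHermitian := by
    simpa [conjTranspose_eq_transpose_of_trivial] using isHermitian_mul_conjTranspose_self C
  have h2 : (Cᵀ * C).IsHermitian := by
    simpa [conjTranspose_eq_transpose_of_trivial] using isHermitian_conjTranspose_mul_self C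
  rw [trace_cfc_eq_sum_roots h1, trace_cfc_eq_sum_roots h2]
  -- The two characteristic polynomials agree up to powers of `X`; the extra roots are `0` and
  -- contribute `g 0 = 0`.
  have h := congrArg Polynomial.roots (charpoly_mul_comm' C Cᵀ)
  rw [roots_mul (mul_ne_zero (pow_ne_zero _ X_ne_zero) (charpoly_monic _).ne_zero),
    roots_mul (mul_ne_zero (pow_ne_zero _ X_ne_zero) (charpoly_monic _).ne_zero)] at h
  have h' := congrArg (fun s : Multiset ℝ => (s.map g).sum) h
  simpa [Multiset.map_nsmul, Multiset.sum_nsmul, hg] using h'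

theorem continuous_inv_posDef :
    Continuous fun A : {A : Matrix n n ℝ // A.PosDef} => (A : Matrix n n ℝ)⁻¹ := by
  have hc : Continuous fun A : {A : Matrix n n ℝ // A.PosDef} => (A : Matrix n n ℝ) :=
    continuous_subtype_val
  simp_rw [Matrix.inv_def, Ring.inverse_eq_inv']
  exact (hc.matrix_det.inv₀ fun A => A.2.det_pos.ne').smul hc.matrix_adjugate

/-- The square root of the inverse of a positive definite matrix. -/
noncomputable def invSqrt (A : Matrix n n ℝ) : Matrix n n ℝ := cfc Real.sqrt A⁻¹

theorem continuous_invSqrt :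
    Continuous fun A : {A : Matrix n n ℝ // A.PosDef} => invSqrt (A : Matrix n n ℝ) :=
  continuous_cfc_of_isHermitian Real.continuous_sqrt continuous_inv_posDef fun A => A.2.inv.1

theorem transpose_cfc (g : ℝ → ℝ) (A : Matrix n n ℝ) : (cfc g A)ᵀ = cfc g A := by
  have h : IsSelfAdjoint (cfc g A) := cfc_predicate g A
  simpa [IsSelfAdjoint, star_eq_conjTranspose, conjTranspose_eq_transpose_of_trivial] using h

theorem transpose_invSqrt (A : Matrix n n ℝ) : (invSqrt A)ᵀ = invSqrt A :=
  transpose_cfc _ _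

theorem invSqrt_mul_self {A : Matrix n n ℝ} (hA : A.PosDef) : invSqrt A * invSqrt A = A⁻¹ := by
  obtain ⟨U, h1, -, hg⟩ := exists_orthogonal_diagonalization hA.inv.1
  have hid : A⁻¹ = U * diagonal (id ∘ hA.inv.1.eigenvalues) * Uᵀ :=
    (cfc_id ℝ A⁻¹ hA.inv.1).symm.trans (hg id)
  calc invSqrt A * invSqrt A
      = U * diagonal (Real.sqrt ∘ hA.inv.1.eigenvalues) * (Uᵀ * U)
          * diagonal (Real.sqrt ∘ hA.inv.1.eigenvalues) * Uᵀ := by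
        rw [invSqrt, hg]; simp only [Matrix.mul_assoc]
    _ = A⁻¹ := by
        rw [h1, Matrix.mul_one, Matrix.mul_assoc U, diagonal_mul_diagonal]
        refine Eq.trans ?_ hid.symm
        congr 3
        ext i
        exact Real.mul_self_sqrt (hA.inv.eigenvalues_pos i).le

/-- Simultaneous diagonalization of `A` and `D`: the columns of `Y` are orthonormal for `A` and
orthogonal for `D`. -/
theorem exists_simultaneous_diagonalization {A D : Matrix n n ℝ} (hA : A.PosDef)
    (hD : D.PosSemidef) :
    ∃ (Y : Matrix n n ℝ) (a : n → ℝ), (∀ i, 0 ≤ a i) ∧ Yᵀ * A * Y = 1 ∧ Y * Yᵀ * A = 1 ∧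
      Yᵀ * D * Y = diagonal a ∧
      (∀ g : ℝ → ℝ, invSqrt A * cfc g (invSqrt A * D * invSqrt A) * invSqrt A =
        Y * diagonal (g ∘ a) * Yᵀ) ∧
      ∀ g : ℝ → ℝ, (cfc g (invSqrt A * D * invSqrt A)).trace = ∑ i, g (a i) := by
  set S := invSqrt A
  have hSt : Sᵀ = S := transpose_invSqrt A
  have hSS : S * S = A⁻¹ := invSqrt_mul_self hA
  have hdet : IsUnit A.det := hA.det_pos.ne'.isUnit
  have hSSA : S * S * A = 1 := by rw [hSS, nonsing_inv_mul _ hdet]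
  have hSAS : S * A * S = 1 := by
    rw [Matrix.mul_assoc] at hSSA
    exact mul_eq_one_comm.1 hSSA
  have hK : (S * D * S).PosSemidef := by
    have := hD.mul_mul_conjTranspose_same S
    rwa [conjTranspose_eq_transpose_of_trivial, hSt] at this
  obtain ⟨U, h1, h2, hg⟩ := exists_orthogonal_diagonalization hK.1
  have hid : S * D * S = U * diagonal (id ∘ hK.1.eigenvalues) * Uᵀ :=
    (cfc_id ℝ (S * D * S) hK.1).symm.trans (hg id)
  refine ⟨S * U, hK.1.eigenvalues, hK.eigenvalues_nonneg, ?_, ?_, ?_, fun g => ?_,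
    trace_cfc_eq_sum_eigenvalues hK.1⟩
  · calc (S * U)ᵀ * A * (S * U) = Uᵀ * (S * A * S) * U := by
          rw [transpose_mul, hSt]; simp only [Matrix.mul_assoc]
      _ = 1 := by rw [hSAS, Matrix.mul_one, h1]
  · calc S * U * (S * U)ᵀ * A = S * (U * Uᵀ) * S * A := by
          rw [transpose_mul, hSt]; simp only [Matrix.mul_assoc]
      _ = 1 := by rw [h2, Matrix.mul_one, hSSA]
  · calc (S * U)ᵀ * D * (S * U) = Uᵀ * (S * D * S) * U := by
          rw [transpose_mul, hSt]; simp only [Matrix.mul_assoc]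
      _ = (Uᵀ * U) * diagonal hK.1.eigenvalues * (Uᵀ * U) := by
          conv_lhs => rw [hid]
          simp only [Matrix.mul_assoc, Function.id_comp]
      _ = _ := by rw [h1, Matrix.one_mul, Matrix.mul_one]
  · rw [hg, transpose_mul, hSt]
    simp only [Matrix.mul_assoc]

end FunctionalCalculus

/-! ### Overlaps of two simultaneous diagonalizations and scalar inequalities -/

section Overlap

variable {n : Type*} [Fintype n] [DecidableEq n]

/-- Comparison of two simultaneous diagonalizations. -/
theorem exists_overlap {A A' D Y Z : Matrix n n ℝ} {a b : n → ℝ}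
    (hAt : Aᵀ = A) (hAt' : A'ᵀ = A')
    (hY : Yᵀ * A * Y = 1) (hY' : Y * Yᵀ * A = 1) (hYD : Yᵀ * D * Y = diagonal a)
    (hZ : Zᵀ * A' * Z = 1) (hZ' : Z * Zᵀ * A' = 1) (hZD : Zᵀ * D * Z = diagonal b) :
    ∃ R T : Matrix n n ℝ, (∀ i j, b j * R j i = T j i * a i) ∧
      (∀ i, ∑ j, R j i * T j i = 1) ∧ (∀ j, ∑ i, R j i * T j i = 1) ∧
      ∀ i, (Yᵀ * A' * Y) i i = ∑ j, R j i ^ 2 := by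
  have hY'' : A * Y * Yᵀ = 1 := by
    have := congrArg transpose hY'
    simpa [transpose_mul, hAt, Matrix.mul_assoc] using this
  have hZ'' : A' * Z * Zᵀ = 1 := by
    have := congrArg transpose hZ'
    simpa [transpose_mul, hAt', Matrix.mul_assoc] using this
  have hRT : (Zᵀ * A' * Y)ᵀ * (Zᵀ * A * Y) = 1 := by
    calc (Zᵀ * A' * Y)ᵀ * (Zᵀ * A * Y) = Yᵀ * (A' * Z * Zᵀ) * A * Y := by
          simp only [transpose_mul, transpose_transpose, hAt', Matrix.mul_assoc]
      _ = 1 := by rw [hZ'', Matrix.mul_one, hY]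
  have hRT' : (Zᵀ * A' * Y) * (Zᵀ * A * Y)ᵀ = 1 := by
    calc (Zᵀ * A' * Y) * (Zᵀ * A * Y)ᵀ = Zᵀ * A' * (Y * Yᵀ * A) * Z := by
          simp only [transpose_mul, transpose_transpose, hAt, Matrix.mul_assoc]
      _ = 1 := by rw [hY', Matrix.mul_one, hZ]
  have hRR : (Zᵀ * A' * Y)ᵀ * (Zᵀ * A' * Y) = Yᵀ * A' * Y := by
    calc (Zᵀ * A' * Y)ᵀ * (Zᵀ * A' * Y) = Yᵀ * (A' * Z * Zᵀ) * A' * Y := by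
          simp only [transpose_mul, transpose_transpose, hAt', Matrix.mul_assoc]
      _ = _ := by rw [hZ'', Matrix.mul_one]
  have hD : diagonal b * (Zᵀ * A' * Y) = (Zᵀ * A * Y) * diagonal a := by
    calc diagonal b * (Zᵀ * A' * Y) = Zᵀ * D * (Z * Zᵀ * A') * Y := by
          rw [← hZD]; simp only [Matrix.mul_assoc]
      _ = Zᵀ * (A * Y * Yᵀ) * D * Y := by rw [hZ', hY'', Matrix.mul_one, Matrix.mul_one]
      _ = _ := by rw [← hYD]; simp only [Matrix.mul_assoc]
  -- Here `R = Z⁻¹ Y` and `T = (R⁻¹)ᵀ`. The relation between `a` and `b` comes from computing `Zᵀ D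
  -- Y` in both bases.
  refine ⟨Zᵀ * A' * Y, Zᵀ * A * Y, fun i j => ?_, fun i => ?_, fun j => ?_, fun i => ?_⟩
  · simpa [diagonal_mul, mul_diagonal] using congrFun (congrFun hD j) i
  · have := congrFun (congrFun hRT i) i
    simpa only [mul_apply (M := (Zᵀ * A' * Y)ᵀ), transpose_apply (Zᵀ * A' * Y),
      one_apply_eq] using this
  · have := congrFun (congrFun hRT' j) j
    simpa only [mul_apply (M := (Zᵀ * A' * Y)), transpose_apply (Zᵀ * A * Y),
      one_apply_eq] using this
  · rw [← hRR]
    simp only [mul_apply (M := (Zᵀ * A' * Y)ᵀ), transpose_apply (Zᵀ * A' * Y), pow_two]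

theorem trace_mul_diagonal_mul_transpose (Y A : Matrix n n ℝ) (ψ : n → ℝ) :
    (Y * diagonal ψ * Yᵀ * A).trace = ∑ i, ψ i * (Yᵀ * A * Y) i i := by
  rw [Matrix.mul_assoc (Y * diagonal ψ), trace_mul_comm, ← Matrix.mul_assoc, trace_mul_comm]
  simp [trace, diagonal_mul]

end Overlap

section OverlapPointwise

variable {n : Type*} {R T : Matrix n n ℝ} {a b : n → ℝ}

/-- The pointwise estimates behind the convexity of the `p`-mean criteria. -/
theorem rpow_overlap_le (ha : ∀ i, 0 ≤ a i) (hb : ∀ j, 0 ≤ b j)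
    (h : ∀ i j, b j * R j i = T j i * a i) {p τ τ' : ℝ} (hp : 0 < p) (hτ : 0 < τ) (hτ' : 0 < τ')
    (i j : n) :
    a i ^ p * (R j i * T j i) * (1 + (Real.log τ - Real.log τ' + 1) / p)
      - b j ^ p * (R j i * T j i) * (τ / (τ' * p)) ≤ a i ^ p * R j i ^ 2 := by
  have hij := h i j
  rcases (ha i).eq_or_lt with h0 | hai
  · rw [← h0, mul_zero] at hij
    have hs : b j ^ p * (R j i * T j i) = 0 := by
      rcases mul_eq_zero.1 hij with hb0 | hR
      · rw [hb0, Real.zero_rpow hp.ne', zero_mul]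
      · rw [hR, zero_mul, mul_zero]
    rw [← h0, Real.zero_rpow hp.ne', hs]
    simp
  rcases (hb j).eq_or_lt with h0 | hbj
  · rw [← h0, zero_mul] at hij
    have hT : T j i = 0 := (mul_eq_zero.1 hij.symm).resolve_right hai.ne'
    rw [hT]
    simp only [mul_zero, zero_mul, sub_zero]
    positivity
  -- In the remaining case the weight `R j i * T j i` equals `R j i ^ 2 * (b j / a i)`, which is
  -- nonnegative.
  have hT : T j i = b j * R j i / a i := by rw [hij]; field_simp
  have hx : 0 < a i / b j := by positivity
  have hl1 := Real.log_le_sub_one_of_pos hx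
  rw [Real.log_div hai.ne' hbj.ne'] at hl1
  -- The second use of `log x ≤ x - 1` bounds `log (a i / b j)` below by a term linear in `b j ^ p`.
  -- The factor `τ / τ'` normalizes the two power sums, so that the corrections cancel after
  -- summation.
  have hy : 0 < (b j ^ p / a i ^ p) * (τ / τ') := by positivity
  have hl2 := Real.log_le_sub_one_of_pos hy
  rw [Real.log_mul (by positivity) (by positivity), Real.log_div (by positivity) (by positivity),
    Real.log_div hτ.ne' hτ'.ne', Real.log_rpow hbj, Real.log_rpow hai] at hl2
  have key : 1 + (Real.log τ - Real.log τ' + 1) / p - (b j ^ p / a i ^ p) * (τ / τ') / p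
      ≤ a i / b j := by
    have : (Real.log τ - Real.log τ' + 1) / p - (b j ^ p / a i ^ p) * (τ / τ') / p
        ≤ Real.log (a i) - Real.log (b j) := by
      rw [← sub_div, div_le_iff₀ hp]
      linarith
    linarith
  have hs : 0 ≤ a i ^ p * (R j i ^ 2 * (b j / a i)) := by positivity
  have := mul_le_mul_of_nonneg_left key hs
  have hap : 0 < a i ^ p := by positivity
  calc _ = a i ^ p * (R j i ^ 2 * (b j / a i)) * (1 + (Real.log τ - Real.log τ' + 1) / p
          - (b j ^ p / a i ^ p) * (τ / τ') / p) := by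
        rw [hT]; field_simp
    _ ≤ _ := this
    _ = _ := by field_simp

/-- Analogue of `rpow_overlap_le` with one use of `log x ≤ x - 1`. Indices with `a i = 0` are
harmless, because there `b j = 0` or `R j i = 0`, and `Real.log 0 = 0`. -/
theorem log_overlap_le (ha : ∀ i, 0 ≤ a i) (hb : ∀ j, 0 ≤ b j)
    (h : ∀ i j, b j * R j i = T j i * a i) (i j : n) :
    (if a i = 0 then 0 else 1) * (1 + Real.log (a i)) * (R j i * T j i)
      - Real.log (b j) * (R j i * T j i) ≤ (if a i = 0 then 0 else 1) * R j i ^ 2 := by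
  have hij := h i j
  rcases (ha i).eq_or_lt with h0 | hai
  · rw [← h0, mul_zero] at hij
    rcases mul_eq_zero.1 hij with hb0 | hR
    · simp [← h0, hb0]
    · simp [hR]
  rw [if_neg hai.ne', one_mul, one_mul]
  rcases (hb j).eq_or_lt with h0 | hbj
  · rw [← h0, zero_mul] at hij
    have hT : T j i = 0 := (mul_eq_zero.1 hij.symm).resolve_right hai.ne'
    rw [hT]
    simp only [mul_zero, sub_zero]
    positivity
  have hT : T j i = b j * R j i / a i := by rw [hij]; field_simp
  have hl1 := Real.log_le_sub_one_of_pos (show 0 < a i / b j by positivity)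
  rw [Real.log_div hai.ne' hbj.ne'] at hl1
  have hs : 0 ≤ R j i ^ 2 * (b j / a i) := by positivity
  have := mul_le_mul_of_nonneg_left
    (show 1 + Real.log (a i) - Real.log (b j) ≤ a i / b j by linarith) hs
  calc _ = R j i ^ 2 * (b j / a i) * (1 + Real.log (a i) - Real.log (b j)) := by
        rw [hT]; field_simp
    _ ≤ _ := this
    _ = _ := by field_simp

end OverlapPointwise

section OverlapSum

variable {n : Type*} [Fintype n] {R T : Matrix n n ℝ} {a b : n → ℝ}

theorem sum_rpow_overlap_le (ha : ∀ i, 0 ≤ a i) (hb : ∀ j, 0 ≤ b j)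
    (h : ∀ i j, b j * R j i = T j i * a i) (h1 : ∀ i, ∑ j, R j i * T j i = 1)
    (h2 : ∀ j, ∑ i, R j i * T j i = 1) {p : ℝ} (hp : 0 < p)
    (hτ : 0 < ∑ i, a i ^ p) (hτ' : 0 < ∑ j, b j ^ p) :
    (∑ i, a i ^ p) * (1 + (Real.log (∑ i, a i ^ p) - Real.log (∑ j, b j ^ p)) / p) ≤
      ∑ i, a i ^ p * ∑ j, R j i ^ 2 := by
  have hsum := Finset.sum_le_sum fun i (_ : i ∈ Finset.univ) =>
    Finset.sum_le_sum fun j (_ : j ∈ Finset.univ) => rpow_overlap_le ha hb h hp hτ hτ' i j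
  simp only [← Finset.mul_sum] at hsum
  refine le_trans (le_of_eq ?_) hsum
  -- Row and column sums equal to `1` turn the weighted sums into `τ` and `τ'`; the subtracted part
  -- becomes `τ / p` and cancels the extra `1 / p`.
  simp only [Finset.sum_sub_distrib]
  rw [Finset.sum_comm (f := fun i j => b j ^ p * (R j i * T j i) * _)]
  simp only [← Finset.mul_sum, ← Finset.sum_mul, h1, h2, mul_one]
  field_simp
  ring

theorem sum_log_overlap_le (ha : ∀ i, 0 ≤ a i) (hb : ∀ j, 0 ≤ b j)
    (h : ∀ i j, b j * R j i = T j i * a i) (h1 : ∀ i, ∑ j, R j i * T j i = 1)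
    (h2 : ∀ j, ∑ i, R j i * T j i = 1) :
    (∑ i, if a i = 0 then 0 else 1) + ∑ i, Real.log (a i) - ∑ j, Real.log (b j) ≤
      ∑ i, (if a i = 0 then 0 else 1) * ∑ j, R j i ^ 2 := by
  have hsum := Finset.sum_le_sum fun i (_ : i ∈ Finset.univ) =>
    Finset.sum_le_sum fun j (_ : j ∈ Finset.univ) => log_overlap_le ha hb h i j
  simp only [← Finset.mul_sum] at hsum
  refine le_trans (le_of_eq ?_) hsum
  simp only [Finset.sum_sub_distrib]
  rw [Finset.sum_comm (f := fun i j => Real.log (b j) * (R j i * T j i))]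
  simp only [← Finset.mul_sum, h1, h2, mul_one, ← Finset.sum_add_distrib]
  congr 1
  refine Finset.sum_congr rfl fun i _ => ?_
  split_ifs with h0 <;> simp [h0]

end OverlapSum

/-! ### Calculus of continuous subgradients -/

section Subgradient

variable {n : Type*} [Fintype n]

/-- `Ψ` is continuous on the positive definite matrices and `A ↦ ⟨G A, ·⟩` is a continuous choice
of subgradients for it (in particular `Ψ` is convex and differentiable there). -/
structure IsContinuousSubgradient (Ψ : Matrix n n ℝ → ℝ) (G : Matrix n n ℝ → Matrix n n ℝ) :
    Prop where
  le : ∀ ⦃A A' : Matrix n n ℝ⦄, A.PosDef → A'.PosDef → Ψ A + (G A * (A' - A)).trace ≤ Ψ A'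
  continuousOn : ContinuousOn Ψ {A | A.PosDef}
  continuousOn_grad : ContinuousOn G {A | A.PosDef}

namespace IsContinuousSubgradient

variable {Ψ Ψ' : Matrix n n ℝ → ℝ} {G : Matrix n n ℝ → Matrix n n ℝ}

theorem congr (h : IsContinuousSubgradient Ψ G) (hΨ : ∀ A, A.PosDef → Ψ' A = Ψ A) :
    IsContinuousSubgradient Ψ' G where
  le A A' hA hA' := by rw [hΨ A hA, hΨ A' hA']; exact h.le hA hA'
  continuousOn := h.continuousOn.congr hΨ
  continuousOn_grad := h.continuousOn_grad

theorem const_mul (h : IsContinuousSubgradient Ψ G) {r : ℝ} (hr : 0 ≤ r) :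
    IsContinuousSubgradient (fun A => r * Ψ A) (fun A => r • G A) where
  le A A' hA hA' := by
    rw [smul_mul, trace_smul, smul_eq_mul, ← mul_add]
    exact mul_le_mul_of_nonneg_left (h.le hA hA') hr
  continuousOn := continuousOn_const.mul h.continuousOn
  continuousOn_grad := h.continuousOn_grad.const_smul r

theorem add_const (h : IsContinuousSubgradient Ψ G) (r : ℝ) :
    IsContinuousSubgradient (fun A => Ψ A + r) G where
  le A A' hA hA' := by linarith [h.le hA hA']
  continuousOn := h.continuousOn.add continuousOn_const
  continuousOn_grad := h.continuousOn_grad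

/-- The tangent line inequality `1 + t ≤ exp t` at `t = Ψ A' - Ψ A` gives the chain rule for
subgradients. -/
theorem exp (h : IsContinuousSubgradient Ψ G) :
    IsContinuousSubgradient (fun A => Real.exp (Ψ A)) (fun A => Real.exp (Ψ A) • G A) where
  le A A' hA hA' := by
    rw [smul_mul, trace_smul, smul_eq_mul]
    have h1 := Real.add_one_le_exp (Ψ A' - Ψ A)
    have h2 : Real.exp (Ψ A') = Real.exp (Ψ A) * Real.exp (Ψ A' - Ψ A) := by
      rw [← Real.exp_add]; ring_nf
    rw [h2]
    nlinarith [h.le hA hA', Real.exp_pos (Ψ A)]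
  continuousOn := h.continuousOn.rexp
  continuousOn_grad := h.continuousOn.rexp.smul h.continuousOn_grad

/-- The subgradient at `A` bounds the quotient below and the one at the moving point bounds it
above; continuity of `G` closes the gap. The endpoint `A'` may be singular, as for one-point
designs, since the segment is positive definite for `t < 1`. -/
theorem tendsto_slope (h : IsContinuousSubgradient Ψ G) {A A' : Matrix n n ℝ} (hA : A.PosDef)
    (hA' : A'.PosSemidef) :
    Tendsto (fun t : ℝ => (Ψ ((1 - t) • A + t • A') - Ψ A) / t) (𝓝[>] 0)
      (𝓝 (G A * (A' - A)).trace) := by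
  have hPD : ∀ᶠ t : ℝ in 𝓝[>] 0, ((1 - t) • A + t • A').PosDef := by
    filter_upwards [Ioo_mem_nhdsGT one_pos] with t ht
    exact (hA.smul (sub_pos.2 ht.2)).add_posSemidef (hA'.smul ht.1.le)
  have hpath : Tendsto (fun t : ℝ => (1 - t) • A + t • A') (𝓝[>] 0) (𝓝[{A | A.PosDef}] A) := by
    refine tendsto_nhdsWithin_iff.2 ⟨?_, hPD⟩
    have hc : Continuous fun t : ℝ => (1 - t) • A + t • A' := by fun_prop
    simpa using (hc.tendsto 0).mono_left nhdsWithin_le_nhds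
  have hG : Tendsto (fun t : ℝ => (G ((1 - t) • A + t • A') * (A' - A)).trace) (𝓝[>] 0)
      (𝓝 (G A * (A' - A)).trace) := by
    have hc : Continuous fun X : Matrix n n ℝ => (X * (A' - A)).trace :=
      (continuous_id.matrix_mul continuous_const).matrix_trace
    exact (hc.tendsto _).comp ((h.continuousOn_grad A hA).tendsto.comp hpath)
  refine tendsto_of_tendsto_of_tendsto_of_le_of_le' tendsto_const_nhds hG ?_ ?_
  · filter_upwards [hPD, self_mem_nhdsWithin] with t ht ht0
    have h1 := h.le hA ht
    rw [show (1 - t) • A + t • A' - A = t • (A' - A) by module, Matrix.mul_smul, trace_smul,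
      smul_eq_mul] at h1
    rw [le_div_iff₀ ht0]
    linarith
  · filter_upwards [hPD, self_mem_nhdsWithin] with t ht ht0
    have h1 := h.le ht hA
    rw [show A - ((1 - t) • A + t • A') = (-t) • (A' - A) by module, Matrix.mul_smul, trace_smul,
      smul_eq_mul] at h1
    rw [div_le_iff₀ ht0]
    linarith

end IsContinuousSubgradient

end Subgradient

/-! ### Subgradients of the `Φ_p` criteria in the information matrix -/

section Transpose

variable {n k : Type*}

theorem transpose_eq_of_posDef {A : Matrix n n ℝ} (hA : A.PosDef) : Aᵀ = A := by
  simpa [conjTranspose_eq_transpose_of_trivial] using hA.1.eq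

theorem posSemidef_transpose_mul_self [Finite n] [Fintype k] (B : Matrix k n ℝ) : (Bᵀ * B).PosSemidef := by
  simpa [conjTranspose_eq_transpose_of_trivial] using posSemidef_conjTranspose_mul_self B

theorem mul_inv_mul_transpose_eq [Fintype n] [DecidableEq n] (B : Matrix k n ℝ) {A : Matrix n n ℝ} (hA : A.PosDef) :
    B * A⁻¹ * Bᵀ = (B * invSqrt A) * (B * invSqrt A)ᵀ := by
  rw [← invSqrt_mul_self hA, transpose_mul, transpose_invSqrt]
  simp only [Matrix.mul_assoc]

theorem transpose_mul_self_eq [Fintype n] [DecidableEq n] [Fintype k] (B : Matrix k n ℝ) (A : Matrix n n ℝ) :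
    (B * invSqrt A)ᵀ * (B * invSqrt A) = invSqrt A * (Bᵀ * B) * invSqrt A := by
  rw [transpose_mul, transpose_invSqrt]
  simp only [Matrix.mul_assoc]

end Transpose

section Criteria

variable {n k : Type*} [Fintype n] [DecidableEq n] [Fintype k] [DecidableEq k]

/-- Moves the trace to a matrix congruent to the fixed `BᵀB`, the form to which simultaneous
diagonalization with `A` applies. -/
theorem trace_cfc_mul_inv_mul_transpose (B : Matrix k n ℝ) {A : Matrix n n ℝ} (hA : A.PosDef)
    {g : ℝ → ℝ} (hg : g 0 = 0) :
    (cfc g (B * A⁻¹ * Bᵀ)).trace =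
      (cfc g (invSqrt A * (Bᵀ * B) * invSqrt A)).trace := by
  rw [mul_inv_mul_transpose_eq B hA, trace_cfc_mul_transpose_comm _ hg, transpose_mul_self_eq]

theorem trace_cfc_rpow_pos {B : Matrix k n ℝ} (hB : B ≠ 0) {p : ℝ} (hp : 0 < p)
    {A : Matrix n n ℝ} (hA : A.PosDef) :
    0 < (cfc (fun t : ℝ => t ^ p) (B * A⁻¹ * Bᵀ)).trace := by
  have hg : (fun t : ℝ => t ^ p) 0 = 0 := Real.zero_rpow hp.ne'
  rw [trace_cfc_mul_inv_mul_transpose B hA hg]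
  obtain ⟨Y, a, ha, -, hY', hD, -, htr⟩ :=
    exists_simultaneous_diagonalization hA (posSemidef_transpose_mul_self B)
  rw [htr]
  refine (Finset.sum_nonneg fun i _ => Real.rpow_nonneg (ha i) p).lt_of_ne' fun h0 => hB ?_
  rw [Finset.sum_eq_zero_iff_of_nonneg fun i _ => Real.rpow_nonneg (ha i) p] at h0
  have ha0 : a = 0 := funext fun i =>
    ((Real.rpow_eq_zero (ha i) hp.ne').1 (h0 i (Finset.mem_univ i)))
  -- All `a i` vanish, so the Gram matrix of `B * Y` is zero; `Y` is invertible, hence `B = 0`.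
  have hBY : B * Y = 0 := by
    rw [← conjTranspose_mul_self_eq_zero, conjTranspose_eq_transpose_of_trivial, transpose_mul,
      Matrix.mul_assoc, ← Matrix.mul_assoc Bᵀ, ← Matrix.mul_assoc, hD, ha0]
    exact diagonal_zero
  calc B = B * (Y * Yᵀ * A) := by rw [hY', Matrix.mul_one]
    _ = (B * Y) * (Yᵀ * A) := by simp only [Matrix.mul_assoc]
    _ = 0 := by rw [hBY, Matrix.zero_mul]

theorem isContinuousSubgradient_log_trace_rpow {B : Matrix k n ℝ} (hB : B ≠ 0) {p : ℝ}
    (hp : 0 < p) :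
    IsContinuousSubgradient
      (fun A : Matrix n n ℝ => Real.log (cfc (fun t : ℝ => t ^ p) (B * A⁻¹ * Bᵀ)).trace / p)
      (fun A => -((cfc (fun t : ℝ => t ^ p) (B * A⁻¹ * Bᵀ)).trace)⁻¹ •
        (invSqrt A * cfc (fun t : ℝ => t ^ p) (invSqrt A * (Bᵀ * B) * invSqrt A) *
          invSqrt A)) := by
  have h0 : (fun t : ℝ => t ^ p) 0 = 0 := Real.zero_rpow hp.ne'
  have hg : Continuous fun t : ℝ => t ^ p := Real.continuous_rpow_const hp.le
  have hcK : Continuous fun A : {A : Matrix n n ℝ // A.PosDef} =>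
      cfc (fun t : ℝ => t ^ p) (invSqrt (A : Matrix n n ℝ) * (Bᵀ * B) * invSqrt A.1) := by
    refine continuous_cfc_of_isHermitian hg
      ((continuous_invSqrt.matrix_mul continuous_const).matrix_mul continuous_invSqrt) fun A => ?_
    have := ((posSemidef_transpose_mul_self B).mul_mul_conjTranspose_same (invSqrt A.1)).1
    rwa [conjTranspose_eq_transpose_of_trivial, transpose_invSqrt] at this
  have hcτ : Continuous fun A : {A : Matrix n n ℝ // A.PosDef} =>
      (cfc (fun t : ℝ => t ^ p) (B * A.1⁻¹ * Bᵀ)).trace :=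
    hcK.matrix_trace.congr fun A => (trace_cfc_mul_inv_mul_transpose B A.2 h0).symm
  have hpos : ∀ A : {A : Matrix n n ℝ // A.PosDef}, _ := fun A => trace_cfc_rpow_pos hB hp A.2
  refine ⟨fun A A' hA hA' => ?_, ?_, ?_⟩
  · have hτ := trace_cfc_rpow_pos hB hp hA
    have hτ' := trace_cfc_rpow_pos hB hp hA'
    rw [trace_cfc_mul_inv_mul_transpose B hA h0] at hτ ⊢
    rw [trace_cfc_mul_inv_mul_transpose B hA' h0] at hτ' ⊢
    obtain ⟨Y, a, ha, hY, hY', hYD, hYg, hYt⟩ :=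
      exists_simultaneous_diagonalization hA (posSemidef_transpose_mul_self B)
    obtain ⟨Z, b, hb, hZ, hZ', hZD, -, hZt⟩ :=
      exists_simultaneous_diagonalization hA' (posSemidef_transpose_mul_self B)
    obtain ⟨R, T, hRT, h1, h2, hR⟩ := exists_overlap (transpose_eq_of_posDef hA)
      (transpose_eq_of_posDef hA') hY hY' hYD hZ hZ' hZD
    rw [hYt] at hτ ⊢
    rw [hZt] at hτ' ⊢
    -- In the basis `Y` the gradient paired with `A` gives `-1`, and paired with `A'` it gives the
    -- overlap sum divided by `-τ`.
    have key := sum_rpow_overlap_le ha hb hRT h1 h2 hp hτ hτ'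
    rw [hYg, smul_mul, trace_smul, mul_sub, trace_sub, trace_mul_diagonal_mul_transpose,
      trace_mul_diagonal_mul_transpose, hY]
    simp only [hR, one_apply_eq, mul_one, Function.comp_apply, smul_eq_mul]
    set τ := ∑ i, a i ^ p
    set τ' := ∑ i, b i ^ p
    have : 1 + (Real.log τ - Real.log τ') / p ≤ τ⁻¹ * ∑ i, a i ^ p * ∑ j, R j i ^ 2 := by
      rw [inv_mul_eq_div, le_div_iff₀ hτ]
      linarith
    have h3 : τ⁻¹ * τ = 1 := inv_mul_cancel₀ hτ.ne'
    rw [sub_div] at this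
    linarith
  · rw [continuousOn_iff_continuous_domRestrict]
    exact (hcτ.log fun A => (hpos A).ne').div_const p
  · rw [continuousOn_iff_continuous_domRestrict]
    exact ((hcτ.inv₀ fun A => (hpos A).ne').neg).smul
      ((continuous_invSqrt.matrix_mul hcK).matrix_mul continuous_invSqrt)

/-- The left side is the orthogonal projection onto the row space of `E`. The columns of `E` are
orthogonal, so this is the coordinate space of the nonzero columns. -/
theorem transpose_mul_inv_mul_eq_diagonal {E : Matrix k n ℝ} {a : n → ℝ}
    (hE : Eᵀ * E = diagonal a) (hF : IsUnit (E * Eᵀ).det) :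
    Eᵀ * (E * Eᵀ)⁻¹ * E = diagonal fun i => if a i = 0 then 0 else 1 := by
  have hM : Eᵀ * (E * Eᵀ)⁻¹ * E * diagonal a = diagonal a := by
    calc Eᵀ * (E * Eᵀ)⁻¹ * E * diagonal a = Eᵀ * ((E * Eᵀ)⁻¹ * (E * Eᵀ)) * E := by
          rw [← hE]; simp only [Matrix.mul_assoc]
      _ = diagonal a := by rw [nonsing_inv_mul _ hF, Matrix.mul_one, hE]
  ext r i
  by_cases hi : a i = 0
  · have hcol : ∀ s, E s i = 0 := by
      have h0 : ∑ s, E s i * E s i = 0 := by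
        have := congrFun (congrFun hE i) i
        simpa [mul_apply, hi] using this
      intro s
      have := (Finset.sum_eq_zero_iff_of_nonneg fun s _ => mul_self_nonneg (E s i)).1 h0 s
        (Finset.mem_univ s)
      exact mul_self_eq_zero.1 this
    rw [mul_apply, Finset.sum_eq_zero fun s _ => by rw [hcol, mul_zero]]
    simp only [diagonal_apply]
    split_ifs with h <;> simp_all
  · have := congrFun (congrFun hM r) i
    rw [mul_diagonal, diagonal_apply] at this
    rw [diagonal_apply]
    by_cases hri : r = i
    · subst hri
      rw [if_pos rfl] at this ⊢
      rw [if_neg hi]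
      exact mul_right_cancel₀ hi (by rw [this, one_mul])
    · rw [if_neg hri] at this ⊢
      exact (mul_eq_zero.1 this).resolve_right hi

theorem trace_cfc_log {F : Matrix n n ℝ} (hF : F.PosDef) :
    (cfc Real.log F).trace = Real.log F.det := by
  rw [trace_cfc_eq_sum_eigenvalues hF.1, hF.1.det_eq_prod_eigenvalues]
  simp only [RCLike.ofReal_real_eq_id, id]
  rw [Real.log_prod fun i _ => (hF.eigenvalues_pos i).ne']

/-- Full row rank of `B` makes `B A⁻¹ Bᵀ` positive definite, so `log det` is the trace of its
logarithm. The convention `Real.log 0 = 0` lets this trace pass to `invSqrt A * (Bᵀ * B) * invSqrt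
A`, which may be singular. -/
theorem isContinuousSubgradient_log_det {B : Matrix k n ℝ} (hB : Function.Injective B.vecMul) :
    IsContinuousSubgradient
      (fun A : Matrix n n ℝ => Real.log (B * A⁻¹ * Bᵀ).det)
      (fun A => -(A⁻¹ * Bᵀ * (B * A⁻¹ * Bᵀ)⁻¹ * B * A⁻¹)) := by
  have hF : ∀ {A : Matrix n n ℝ}, A.PosDef → (B * A⁻¹ * Bᵀ).PosDef := fun hA => by
    simpa [conjTranspose_eq_transpose_of_trivial] using hA.inv.mul_mul_conjTranspose_same hB
  have hcF : Continuous fun A : {A : Matrix n n ℝ // A.PosDef} => B * A.1⁻¹ * Bᵀ :=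
    (continuous_const.matrix_mul continuous_inv_posDef).matrix_mul continuous_const
  refine ⟨fun A A' hA hA' => ?_, ?_, ?_⟩
  · obtain ⟨Y, a, ha, hY, hY', hYD, -, hYt⟩ :=
      exists_simultaneous_diagonalization hA (posSemidef_transpose_mul_self B)
    obtain ⟨Z, b, hb, hZ, hZ', hZD, -, hZt⟩ :=
      exists_simultaneous_diagonalization hA' (posSemidef_transpose_mul_self B)
    obtain ⟨R, T, hRT, h1, h2, hR⟩ := exists_overlap (transpose_eq_of_posDef hA)
      (transpose_eq_of_posDef hA') hY hY' hYD hZ hZ' hZD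
    have key := sum_log_overlap_le ha hb hRT h1 h2
    rw [← hYt, ← hZt, ← trace_cfc_mul_inv_mul_transpose B hA Real.log_zero,
      ← trace_cfc_mul_inv_mul_transpose B hA' Real.log_zero, trace_cfc_log (hF hA),
      trace_cfc_log (hF hA')] at key
    have hinv : A⁻¹ = Y * Yᵀ := inv_eq_left_inv hY'
    have hFE : B * A⁻¹ * Bᵀ = (B * Y) * (B * Y)ᵀ := by
      rw [hinv, transpose_mul]; simp only [Matrix.mul_assoc]
    have hE : (B * Y)ᵀ * (B * Y) = diagonal a := by
      rw [← hYD, transpose_mul]; simp only [Matrix.mul_assoc]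
    have hG : A⁻¹ * Bᵀ * (B * A⁻¹ * Bᵀ)⁻¹ * B * A⁻¹ =
        Y * diagonal (fun i => if a i = 0 then 0 else 1) * Yᵀ := by
      have hdet : IsUnit ((B * Y) * (B * Y)ᵀ).det := by
        rw [← hFE]; exact (hF hA).det_pos.ne'.isUnit
      rw [← transpose_mul_inv_mul_eq_diagonal hE hdet, hFE, hinv, transpose_mul]
      simp only [Matrix.mul_assoc]
    rw [hG, neg_mul, trace_neg, mul_sub, trace_sub, trace_mul_diagonal_mul_transpose,
      trace_mul_diagonal_mul_transpose, hY]
    simp only [hR, one_apply_eq, mul_one]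
    linarith
  · rw [continuousOn_iff_continuous_domRestrict]
    exact hcF.matrix_det.log fun A => (hF A.2).det_pos.ne'
  · rw [continuousOn_iff_continuous_domRestrict]
    have hcF' : Continuous fun A : {A : Matrix n n ℝ // A.PosDef} => (B * A.1⁻¹ * Bᵀ)⁻¹ :=
      continuous_inv_posDef.comp (hcF.subtype_mk fun A => hF A.2)
    exact ((((continuous_inv_posDef.matrix_mul continuous_const).matrix_mul hcF').matrix_mul
      continuous_const).matrix_mul continuous_inv_posDef).neg

end Criteria

theorem vecMul_injective_of_isUnit_det {n k : Type*} [Fintype n] [Fintype k] [DecidableEq k]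
    {B : Matrix k n ℝ} {C : Matrix n k ℝ} (h : IsUnit (B * C).det) :
    Function.Injective B.vecMul := by
  have hinj : Function.Injective (B * C).vecMul :=
    vecMul_injective_iff_isUnit.2 ((isUnit_iff_isUnit_det _).2 h)
  refine fun v w hvw => hinj ?_
  have hvw' : v ᵥ* B = w ᵥ* B := hvw
  change v ᵥ* (B * C) = w ᵥ* (B * C)
  rw [← vecMul_vecMul, ← vecMul_vecMul, hvw']

/-- Every member of the `Φ_p` family, as a function of the information matrix, has a continuous
choice of subgradients on the positive definite matrices. -/
theorem PhiKind.exists_subgradient {l q : ℕ} (c : PhiKind) (B : Matrix (Fin q) (Fin l) ℝ)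
    {A₀ : Matrix (Fin l) (Fin l) ℝ} (hpos : 0 < c.scalar (B * A₀⁻¹ * Bᵀ)) :
    ∃ G, IsContinuousSubgradient
      (fun A : Matrix (Fin l) (Fin l) ℝ => c.scalar (B * A⁻¹ * Bᵀ)) G := by
  -- One nonzero determinant forces full row rank of `B`, which then makes the determinant positive
  -- at every positive definite `A`.
  have hinj : (B * A₀⁻¹ * Bᵀ).det ≠ 0 → Function.Injective B.vecMul := fun h =>
    vecMul_injective_of_isUnit_det (B := B) (C := A₀⁻¹ * Bᵀ) (by rw [← Matrix.mul_assoc]; exact h.isUnit)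
  have hdet : Function.Injective B.vecMul → ∀ A : Matrix (Fin l) (Fin l) ℝ, A.PosDef →
      0 < (B * A⁻¹ * Bᵀ).det := fun hB A hA => by
    have := (hA.inv.mul_mul_conjTranspose_same hB).det_pos
    rwa [conjTranspose_eq_transpose_of_trivial] at this
  cases c with
  | power p hp =>
    have hB : B ≠ 0 := by
      rintro rfl
      simp [PhiKind.scalar, cfc_apply_zero, Real.zero_rpow hp.ne',
        Real.zero_rpow (inv_pos.2 hp).ne'] at hpos
    have hq : 0 < (q : ℝ)⁻¹ := by
      rcases Nat.eq_zero_or_pos q with rfl | hq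
      · exact absurd (Subsingleton.elim B 0) hB
      · positivity
    -- The criterion is the exponential of `log tr / p` plus the constant `log q⁻¹ / p`.
    refine ⟨_, (((isContinuousSubgradient_log_trace_rpow hB hp).add_const
      (Real.log (q : ℝ)⁻¹ / p)).exp).congr fun A hA => ?_⟩
    have hτ := trace_cfc_rpow_pos hB hp hA
    rw [PhiKind.scalar, Real.rpow_def_of_pos (mul_pos hq hτ), Real.log_mul hq.ne' hτ.ne']
    congr 1
    ring
  | detRoot =>
    have hB : Function.Injective B.vecMul := hinj fun h => by
      rcases Nat.eq_zero_or_pos q with rfl | hq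
      · simp at h
      · have hq' : (q : ℝ)⁻¹ ≠ 0 := by positivity
        simp [PhiKind.scalar, h, Real.zero_rpow hq'] at hpos
    refine ⟨_, ((isContinuousSubgradient_log_det hB).const_mul
      (r := 1 / (q : ℝ)) (by positivity)).exp.congr fun A hA => ?_⟩
    rw [PhiKind.scalar, Real.rpow_def_of_pos (hdet hB A hA), mul_comm]
  | logDet =>
    -- A zero determinant would give the value `Real.log 0 = 0`, which is not positive.
    have hB : Function.Injective B.vecMul := hinj fun h => by
      simp [PhiKind.scalar, h] at hpos
    exact ⟨_, isContinuousSubgradient_log_det hB⟩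

/-! ### Information matrices as linear functions of the design -/

namespace GLM

variable {d l : ℕ} (M : GLM d l)

theorem weight_nonneg (x : Fin d → ℝ) : 0 ≤ M.weight x :=
  inv_nonneg.2 (mul_nonneg (variance_nonneg _ _) (sq_nonneg _))

theorem fisherInfo_add (ξ η : (Fin d → ℝ) →₀ ℝ) :
    M.fisherInfo (ξ + η) = M.fisherInfo ξ + M.fisherInfo η :=
  Finsupp.sum_add_index' (by simp) fun x a b => by rw [add_mul, add_smul]

theorem fisherInfo_smul (r : ℝ) (ξ : (Fin d → ℝ) →₀ ℝ) :
    M.fisherInfo (r • ξ) = r • M.fisherInfo ξ := by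
  unfold fisherInfo
  rw [Finsupp.sum_smul_index' (by simp), Finsupp.smul_sum]
  refine Finsupp.sum_congr fun x _ => ?_
  rw [smul_eq_mul, mul_assoc, mul_smul]

theorem fisherInfo_eq_sum (ξ : (Fin d → ℝ) →₀ ℝ) :
    M.fisherInfo ξ = ∑ x ∈ ξ.support, ξ x • M.fisherInfo (pointDesign x) := by
  refine Finset.sum_congr rfl fun x _ => ?_
  simp [fisherInfo, pointDesign, smul_smul]

theorem fisherInfo_posSemidef {ξ : (Fin d → ℝ) →₀ ℝ} (hξ : ∀ x, 0 ≤ ξ x) :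
    (M.fisherInfo ξ).PosSemidef := by
  refine posSemidef_sum _ fun x _ => PosSemidef.smul ?_ (mul_nonneg (hξ x) (M.weight_nonneg x))
  simpa using posSemidef_vecMulVec_self_star (M.basis x)

theorem fisherInfo_posDef_iff {ξ : (Fin d → ℝ) →₀ ℝ} (hξ : ∀ x, 0 ≤ ξ x) :
    (M.fisherInfo ξ).PosDef ↔ IsUnit (M.fisherInfo ξ).det := by
  rw [(M.fisherInfo_posSemidef hξ).posDef_iff_isUnit, isUnit_iff_isUnit_det]

end GLM

/-! ### Convex combinations of designs -/

section Designs

variable {d : ℕ} {Ω : Set (Fin d → ℝ)}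

theorem isDesign_pointDesign {x : Fin d → ℝ} (hx : x ∈ Ω) : IsDesign Ω (pointDesign x) := by
  classical
  refine ⟨fun y => ?_, fun y hy => ?_, by simp [pointDesign]⟩
  · rw [pointDesign, Finsupp.single_apply]
    split_ifs <;> norm_num
  · have := Finsupp.support_single_subset hy
    rw [Finset.mem_singleton] at this
    rwa [this]

theorem finsupp_sum_id_add (ξ η : (Fin d → ℝ) →₀ ℝ) :
    ((ξ + η).sum fun _ a => a) = (ξ.sum fun _ a => a) + η.sum fun _ a => a :=
  Finsupp.sum_add_index' (fun _ => rfl) fun _ _ _ => rfl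

theorem finsupp_sum_id_smul (r : ℝ) (ξ : (Fin d → ℝ) →₀ ℝ) :
    ((r • ξ).sum fun _ a => a) = r * ξ.sum fun _ a => a := by
  rw [Finsupp.sum_smul_index' (fun _ => rfl), Finsupp.mul_sum]
  rfl

theorem IsDesign.convexCombination {ξ η : (Fin d → ℝ) →₀ ℝ} (hξ : IsDesign Ω ξ)
    (hη : IsDesign Ω η) {r s : ℝ} (hr : 0 ≤ r) (hs : 0 ≤ s) (hrs : r + s = 1) :
    IsDesign Ω (r • ξ + s • η) := by
  classical
  refine ⟨fun x => ?_, fun x hx => ?_, ?_⟩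
  · exact add_nonneg (mul_nonneg hr (hξ.1 x)) (mul_nonneg hs (hη.1 x))
  · rcases Finset.mem_union.1 (Finsupp.support_add hx) with h | h
    · exact hξ.2.1 (Finsupp.support_smul h)
    · exact hη.2.1 (Finsupp.support_smul h)
  · rw [finsupp_sum_id_add, finsupp_sum_id_smul, finsupp_sum_id_smul, hξ.2.2, hη.2.2]
    linarith

theorem IsDesign.nonempty {ξ : (Fin d → ℝ) →₀ ℝ} (hξ : IsDesign Ω ξ) : Ω.Nonempty := by
  have h : ξ.support.Nonempty := by
    by_contra h
    have h1 := hξ.2.2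
    rw [Finsupp.sum, Finset.not_nonempty_iff_eq_empty.1 h, Finset.sum_empty] at h1
    exact zero_ne_one h1
  exact h.imp fun x hx => hξ.2.1 hx

/-- Finitely many positive definiteness requirements that can be met separately by designs can be
met by one design. -/
theorem exists_isDesign_forall_posDef {m : ℕ} {l : Fin m → ℕ} (M : ∀ j, GLM d (l j))
    (hΩ : ∃ ξ, IsDesign Ω ξ) {ζ : Fin m → (Fin d → ℝ) →₀ ℝ} (hζ : ∀ j, IsDesign Ω (ζ j))
    (hPD : ∀ j, ((M j).fisherInfo (ζ j)).PosDef) :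
    ∃ ξ, IsDesign Ω ξ ∧ ∀ j, ((M j).fisherInfo ξ).PosDef := by
  suffices h : ∀ s : Finset (Fin m), ∃ ξ, IsDesign Ω ξ ∧ ∀ j ∈ s, ((M j).fisherInfo ξ).PosDef by
    simpa using h Finset.univ
  intro s
  induction s using Finset.cons_induction with
  | empty => simpa using hΩ
  | cons i s _ ih =>
    obtain ⟨ξ, hξ, hs⟩ := ih
    -- Averaging preserves positive definiteness already achieved, because the other summand is
    -- positive semidefinite.
    refine ⟨(1 / 2 : ℝ) • ξ + (1 / 2 : ℝ) • ζ i,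
      hξ.convexCombination (hζ i) (by norm_num) (by norm_num) (by norm_num), fun j hj => ?_⟩
    rw [GLM.fisherInfo_add, GLM.fisherInfo_smul, GLM.fisherInfo_smul]
    rcases Finset.mem_cons.1 hj with rfl | hj
    · exact PosDef.posSemidef_add (((M j).fisherInfo_posSemidef hξ.1).smul (by norm_num))
        ((hPD j).smul (by norm_num))
    · exact ((hs j hj).smul (by norm_num)).add_posSemidef
        (((M j).fisherInfo_posSemidef (hζ i).1).smul (by norm_num))

end Designs

/-! ### Directional derivatives and the equivalence theorem -/

section Equivalence

variable {d m : ℕ} {l q : Fin m → ℕ} {c : PhiKind} {M : ∀ j, GLM d (l j)}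
  {f : ∀ j, (Fin (l j) → ℝ) → Fin (q j) → ℝ} {ξopt : Fin m → (Fin d → ℝ) →₀ ℝ}
  {o : Fin m → ℝ} {Ω : Set (Fin d → ℝ)}

theorem se_eq_ofReal (ho : ∀ j, Phi c (M j) (f j) (ξopt j) = o j) {ξ : (Fin d → ℝ) →₀ ℝ}
    (h : ∀ j, IsUnit ((M j).fisherInfo ξ).det) :
    se c M f ξopt ξ =
      ENNReal.ofReal (∑ j, Real.exp (c.scalar ((M j).covMatrix (f j) ξ) / o j)) := by
  rw [ENNReal.ofReal_sum_of_nonneg fun j _ => (Real.exp_pos _).le]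
  refine Finset.sum_congr rfl fun j _ => ?_
  rw [ho, Phi, if_pos (h j), ← EReal.coe_div, EReal.exp_coe]

/-- A singular information matrix gives the summand `exp (⊤ / o j)`, which is `⊤` because `o j` is
positive and finite; all other summands are finite. -/
theorem se_ne_top_iff (ho : ∀ j, Phi c (M j) (f j) (ξopt j) = o j) (hpos : ∀ j, 0 < o j)
    {ξ : (Fin d → ℝ) →₀ ℝ} :
    se c M f ξopt ξ ≠ ⊤ ↔ ∀ j, IsUnit ((M j).fisherInfo ξ).det := by
  refine ⟨fun h j => ?_, fun h => by rw [se_eq_ofReal ho h]; exact ENNReal.ofReal_ne_top⟩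
  by_contra hj
  refine h (ENNReal.sum_eq_top.2 ⟨j, Finset.mem_univ j, ?_⟩)
  rw [ho, Phi, if_neg hj, EReal.top_div_of_pos_ne_top (by exact_mod_cast hpos j)
    (EReal.coe_ne_top _), EReal.exp_top]

theorem toReal_se (ho : ∀ j, Phi c (M j) (f j) (ξopt j) = o j) {ξ : (Fin d → ℝ) →₀ ℝ}
    (h : ∀ j, IsUnit ((M j).fisherInfo ξ).det) :
    (se c M f ξopt ξ).toReal =
      ∑ j, Real.exp (c.scalar ((M j).covMatrix (f j) ξ) / o j) := by
  rw [se_eq_ofReal ho h,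
    ENNReal.toReal_ofReal (Finset.sum_nonneg fun j _ => (Real.exp_pos _).le)]

/-- The directional derivative of `se` at `ξ` in the direction of `η`, in terms of gradients `G j`
with respect to the information matrices. -/
noncomputable def dirDeriv (M : ∀ j, GLM d (l j))
    (G : ∀ j, Matrix (Fin (l j)) (Fin (l j)) ℝ → Matrix (Fin (l j)) (Fin (l j)) ℝ)
    (ξ η : (Fin d → ℝ) →₀ ℝ) : ℝ :=
  ∑ j, (G j ((M j).fisherInfo ξ) * ((M j).fisherInfo η - (M j).fisherInfo ξ)).trace

variable {G : ∀ j, Matrix (Fin (l j)) (Fin (l j)) ℝ → Matrix (Fin (l j)) (Fin (l j)) ℝ}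

theorem dirDeriv_self (ξ : (Fin d → ℝ) →₀ ℝ) : dirDeriv M G ξ ξ = 0 := by
  simp [dirDeriv]

/-- The derivative is affine in the information matrices of `η`, and the weights of `η` add up to
`1`. -/
theorem dirDeriv_eq_sum (ξ : (Fin d → ℝ) →₀ ℝ) {η : (Fin d → ℝ) →₀ ℝ} (hη : IsDesign Ω η) :
    dirDeriv M G ξ η = ∑ x ∈ η.support, η x * dirDeriv M G ξ (pointDesign x) := by
  have h1 : ∑ x ∈ η.support, η x = 1 := hη.2.2
  simp only [dirDeriv, Finset.mul_sum]
  rw [Finset.sum_comm]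
  refine Finset.sum_congr rfl fun j _ => ?_
  have h2 : (M j).fisherInfo η - (M j).fisherInfo ξ =
      ∑ x ∈ η.support, η x • ((M j).fisherInfo (pointDesign x) - (M j).fisherInfo ξ) := by
    simp only [smul_sub, Finset.sum_sub_distrib]
    rw [← Finset.sum_smul, h1, one_smul, ← GLM.fisherInfo_eq_sum]
  rw [h2, Matrix.mul_sum, trace_sum]
  refine Finset.sum_congr rfl fun x _ => ?_
  rw [Matrix.mul_smul, trace_smul, smul_eq_mul]

theorem hasDirDeriv_dirDeriv (ho : ∀ j, Phi c (M j) (f j) (ξopt j) = o j) (hpos : ∀ j, 0 < o j)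
    (hG : ∀ j, IsContinuousSubgradient (fun A : Matrix (Fin (l j)) (Fin (l j)) ℝ => Real.exp
      (c.scalar ((M j).jacobian (f j) * A⁻¹ * ((M j).jacobian (f j))ᵀ) / o j)) (G j))
    {ξ η : (Fin d → ℝ) →₀ ℝ} (hξ : IsDesign Ω ξ) (hη : IsDesign Ω η)
    (hfin : se c M f ξopt ξ ≠ ⊤) :
    HasDirDeriv c M f ξopt η ξ (dirDeriv M G ξ η) := by
  have hu := (se_ne_top_iff ho hpos).1 hfin
  have hPD : ∀ j, ((M j).fisherInfo ξ).PosDef := fun j => ((M j).fisherInfo_posDef_iff hξ.1).2 (hu j)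
  have hev : ∀ᶠ α : ℝ in 𝓝[>] 0, ∀ j, IsUnit ((M j).fisherInfo ((1 - α) • ξ + α • η)).det := by
    filter_upwards [Ioo_mem_nhdsGT one_pos] with α hα j
    rw [GLM.fisherInfo_add, GLM.fisherInfo_smul, GLM.fisherInfo_smul]
    exact (((hPD j).smul (sub_pos.2 hα.2)).add_posSemidef
      (((M j).fisherInfo_posSemidef hη.1).smul hα.1.le)).det_pos.ne'.isUnit
  refine ⟨hfin, hev.mono fun α h => (se_ne_top_iff ho hpos).2 h, ?_⟩
  have hlim := tendsto_finsetSum Finset.univ fun j _ =>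
    (hG j).tendsto_slope (hPD j) ((M j).fisherInfo_posSemidef hη.1)
  refine hlim.congr' (hev.mono fun α h => ?_)
  beta_reduce
  rw [toReal_se ho h, toReal_se ho hu, ← Finset.sum_sub_distrib, Finset.sum_div]
  refine Finset.sum_congr rfl fun j _ => ?_
  rw [← GLM.fisherInfo_smul, ← GLM.fisherInfo_smul, ← GLM.fisherInfo_add]
  rfl

/-- This is convexity of `se` in first-order form; it makes the local condition sufficient for a
global minimum. -/
theorem toReal_se_add_dirDeriv_le (ho : ∀ j, Phi c (M j) (f j) (ξopt j) = o j)
    (hpos : ∀ j, 0 < o j)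
    (hG : ∀ j, IsContinuousSubgradient (fun A : Matrix (Fin (l j)) (Fin (l j)) ℝ => Real.exp
      (c.scalar ((M j).jacobian (f j) * A⁻¹ * ((M j).jacobian (f j))ᵀ) / o j)) (G j))
    {ξ η : (Fin d → ℝ) →₀ ℝ} (hξ : IsDesign Ω ξ) (hη : IsDesign Ω η)
    (hξ' : se c M f ξopt ξ ≠ ⊤) (hη' : se c M f ξopt η ≠ ⊤) :
    (se c M f ξopt ξ).toReal + dirDeriv M G ξ η ≤ (se c M f ξopt η).toReal := by
  rw [se_ne_top_iff ho hpos] at hξ' hη'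
  rw [toReal_se ho hξ', toReal_se ho hη', dirDeriv, ← Finset.sum_add_distrib]
  exact Finset.sum_le_sum fun j _ => (hG j).le (((M j).fisherInfo_posDef_iff hξ.1).2 (hξ' j))
    (((M j).fisherInfo_posDef_iff hη.1).2 (hη' j))

theorem HasDirDeriv.unique {ξ η : (Fin d → ℝ) →₀ ℝ} {D D' : ℝ}
    (h : HasDirDeriv c M f ξopt η ξ D) (h' : HasDirDeriv c M f ξopt η ξ D') : D = D' :=
  tendsto_nhds_unique h.2.2 h'.2.2

theorem HasDirDeriv.nonneg_of_minimizes {ξ η : (Fin d → ℝ) →₀ ℝ} {D : ℝ}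
    (h : HasDirDeriv c M f ξopt η ξ D) (hmin : Minimizes Ω (se c M f ξopt) ξ)
    (hη : IsDesign Ω η) : 0 ≤ D := by
  refine ge_of_tendsto h.2.2 ?_
  filter_upwards [h.2.1, Ioo_mem_nhdsGT one_pos] with α hα hα1
  refine div_nonneg (sub_nonneg.2 (ENNReal.toReal_mono hα (hmin.2 _ ?_))) hα1.1.le
  exact hmin.1.convexCombination hη (sub_nonneg.2 hα1.2.le) hα1.1.le (by ring)

theorem minimizes_lse_iff {ξ : (Fin d → ℝ) →₀ ℝ} :
    Minimizes Ω (lse c M f ξopt) ξ ↔ Minimizes Ω (se c M f ξopt) ξ := by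
  simp only [Minimizes, lse, ENNReal.log_le_log_iff]

end Equivalence

end OptDesign

open OptDesign
theorem theorem1 {d m : ℕ} {l q : Fin m → ℕ}
    (Ω : Set (Fin d → ℝ)) (ν : Measure ℝ)
    (M : ∀ j, GLM d (l j)) (hM : ∀ j, (M j).IsGLM ν Ω)
    (f : ∀ j, (Fin (l j) → ℝ) → Fin (q j) → ℝ)
    (hf : ∀ j, DifferentiableAt ℝ (f j) (M j).coef)
    (c : PhiKind)
    (ξopt : Fin m → (Fin d → ℝ) →₀ ℝ)
    (hopt : ∀ j, Minimizes Ω (Phi c (M j) (f j)) (ξopt j))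
    (hopt_pos : ∀ j, 0 < Phi c (M j) (f j) (ξopt j))
    (hopt_fin : ∀ j, Phi c (M j) (f j) (ξopt j) ≠ ⊤)
    (ξ : (Fin d → ℝ) →₀ ℝ) (hξ : IsDesign Ω ξ) :
    (se c M f ξopt ξ ≠ ⊤ → ∀ x ∈ Ω, ∃ D : ℝ, HasDirDeriv c M f ξopt (pointDesign x) ξ D) ∧
    List.TFAE [
      Minimizes Ω (lse c M f ξopt) ξ,
      Minimizes Ω (se c M f ξopt) ξ,
      ∀ x ∈ Ω, ∃ D : ℝ, HasDirDeriv c M f ξopt (pointDesign x) ξ D ∧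
        0 ≤ D ∧ (x ∈ ξ.support → D = 0),
      ∀ x ∈ Ω, ∃ D : ℝ, HasDirDeriv c M f ξopt (pointDesign x) ξ D ∧ 0 ≤ D] := by
  have hunit : ∀ j, IsUnit ((M j).fisherInfo (ξopt j)).det := fun j => by
    by_contra h
    exact hopt_fin j (if_neg h)
  set o : Fin m → ℝ := fun j => c.scalar ((M j).covMatrix (f j) (ξopt j))
  have ho : ∀ j, Phi c (M j) (f j) (ξopt j) = o j := fun j => if_pos (hunit j)
  have hpos : ∀ j, 0 < o j := fun j => by
    have := hopt_pos j
    rw [ho j] at this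
    exact_mod_cast this
  have hoptPD : ∀ j, ((M j).fisherInfo (ξopt j)).PosDef := fun j =>
    ((M j).fisherInfo_posDef_iff (hopt j).1.1).2 (hunit j)
  have hex : ∀ j, ∃ G, IsContinuousSubgradient (fun A : Matrix (Fin (l j)) (Fin (l j)) ℝ => Real.exp
      (c.scalar ((M j).jacobian (f j) * A⁻¹ * ((M j).jacobian (f j)).transpose) / o j)) G := by
    intro j
    obtain ⟨G, hG⟩ := c.exists_subgradient ((M j).jacobian (f j)) (hpos j)
    -- Division by the positive optimal value and `exp` both preserve continuous subgradients.
    refine ⟨_, (hG.const_mul (inv_nonneg.2 (hpos j).le)).exp.congr fun A _ => ?_⟩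
    rw [div_eq_inv_mul]
  choose G hG using hex
  have hD : ∀ {η}, IsDesign Ω η → se c M f ξopt ξ ≠ ⊤ →
      HasDirDeriv c M f ξopt η ξ (dirDeriv M G ξ η) := fun hη hfin =>
    hasDirDeriv_dirDeriv ho hpos hG hξ hη hfin
  refine ⟨fun hfin x hx => ⟨_, hD (isDesign_pointDesign hx) hfin⟩, ?_⟩
  tfae_have 1 ↔ 2 := minimizes_lse_iff
  tfae_have 2 → 3 := by
    intro hmin
    -- A design with finite criterion value exists, so the minimum is finite.
    obtain ⟨ζ, hζ, hζPD⟩ :=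
      exists_isDesign_forall_posDef M ⟨ξ, hξ⟩ (fun j => (hopt j).1) hoptPD
    have hfin : se c M f ξopt ξ ≠ ⊤ := ne_top_of_le_ne_top
      ((se_ne_top_iff ho hpos).2 fun j => (hζPD j).det_pos.ne'.isUnit) (hmin.2 ζ hζ)
    have hnn : ∀ x ∈ Ω, 0 ≤ dirDeriv M G ξ (pointDesign x) := fun x hx =>
      (hD (isDesign_pointDesign hx) hfin).nonneg_of_minimizes hmin (isDesign_pointDesign hx)
    refine fun x hx => ⟨_, hD (isDesign_pointDesign hx) hfin, hnn x hx, fun hxs => ?_⟩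
    -- The derivative of `se` at `ξ` towards `ξ` itself is `0` and is a sum of nonnegative terms
    -- over the support, so each term vanishes.
    have hsum := dirDeriv_eq_sum (M := M) (G := G) ξ hξ
    rw [dirDeriv_self] at hsum
    have h0 := (Finset.sum_eq_zero_iff_of_nonneg fun y hy =>
      mul_nonneg (hξ.1 y) (hnn y (hξ.2.1 hy))).1 hsum.symm x hxs
    exact (mul_eq_zero.1 h0).resolve_left (Finsupp.mem_support_iff.1 hxs)
  tfae_have 3 → 4 := fun h x hx => (h x hx).imp fun D hD => ⟨hD.1, hD.2.1⟩
  tfae_have 4 → 2 := by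
    intro h
    -- Finiteness at `ξ` is contained in the derivative condition, which needs a point of `Ω` to be
    -- applied.
    obtain ⟨x₀, hx₀⟩ := hξ.nonempty
    obtain ⟨-, ⟨hfin, -⟩, -⟩ := h x₀ hx₀
    have hnn : ∀ x ∈ Ω, 0 ≤ dirDeriv M G ξ (pointDesign x) := fun x hx => by
      obtain ⟨D, hDx, hD0⟩ := h x hx
      rwa [(hD (isDesign_pointDesign hx) hfin).unique hDx]
    refine ⟨hξ, fun η hη => ?_⟩
    by_cases hη' : se c M f ξopt η = ⊤
    · rw [hη']
      exact le_top
    have h1 := toReal_se_add_dirDeriv_le ho hpos hG hξ hη hfin hη'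
    have h2 : 0 ≤ dirDeriv M G ξ η := by
      rw [dirDeriv_eq_sum ξ hη]
      exact Finset.sum_nonneg fun y hy => mul_nonneg (hη.1 y) (hnn y (hη.2.1 hy))
    exact (ENNReal.toReal_le_toReal hfin hη').1 (by linarith)
  tfae_finish
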